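/- Let $G$ be a finite simple bipartite graph whose parts have sizes $n$ (first part) and $m$ (second part). Suppose that every vertex of the first part has degree $a$ and every vertex of the second part has degree $b$ (so that $b = an/m$). Let $v$ be a vertex of the second part, let $\tau^v_{>k}(G)$ denote the number of spanning trees of $G$ in which $v$ has degree strictly greater than $k$, and let $\tau^v_{\le k}(G)$ denote the number of spanning trees of $G$ in which $v$ has degree at most $k$. Let $\theta$ be a real number such that $k=\theta b/a$ is a non-negative integer with $k<b$. Then: (i) if $\theta\ge 1$, then $$\tau^v_{>k}(G)\le\left(\theta^{-1}\exp\left(\frac{\theta-1}{\theta}\right)\right)^k\frac{a^nb^m}{mn};$$ (ii) if $\theta\le 1$ and $m\ge 2$, then $$\tau^v_{\le k+1}(G)\le\left(\theta^{-1}\exp\left(\frac{\theta-1}{\theta}\right)\right)^k\frac{a^nb^m}{(m-1)n}.$$ Here, for $\theta=0$ (equivalently $k=0$), the factor $(\cdots)^k$ is read as $1$. -/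

import Mathlib

/-- The set of spanning trees of `G`: the subgraphs of `G` on the whole vertex set that are
trees (two spanning trees are the same iff they have the same edges). -/
def spanningTrees {V : Type*} (G : SimpleGraph V) : Set (SimpleGraph V) :=
  {T | T ≤ G ∧ T.IsTree}

open Classical in
/-- The number of spanning trees of `G` in which `v` has degree strictly greater than `k`. -/
noncomputable def treesDegGT {V : Type*} [Fintype V] (G : SimpleGraph V) (v : V) (k : ℕ) : ℕ :=
  {T ∈ spanningTrees G | k < T.degree v}.ncard

open Classical in
/-- The number of spanning trees of `G` in which `v` has degree at most `k`. -/
noncomputable def treesDegLE {V : Type*} [Fintype V] (G : SimpleGraph V) (v : V) (k : ℕ) : ℕ :=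
  {T ∈ spanningTrees G | T.degree v ≤ k}.ncard

/-! The proof is a Markov bound on F(z) = ∑_T z^{deg_T v}, taken at z = θ. Give the edges at v
weight z. By `sum_spanningTrees_pow_degree_le`, F(z) is at most the determinant of the Laplacian
grounded at v.

Eliminating the first part factors this determinant into the product of the row sums there and a
cofactor of the Schur complement S on the second part. With d the column sums and s their total, s
times the cofactor is det(S + s⁻¹ddᵀ). That matrix is positive semidefinite, so a Hadamard-type
bound using x ≤ exp(x - 1) applies (`det_bipartiteSchur_updateRow_le`). Biregularity makes the
exponent 1 - n/b, whatever z is, and exp(1 - n/b) ≤ b/n. The row sums contribute at most a^n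
exp((z-1)b/a), since v has b neighbours. The outcome is
`sum_spanningTrees_pow_degree_le_of_biregular`. -/

/-! ### Determinants of parent maps. -/

/-- The matrix whose row at `x ≠ v` is `e_x - e_{f x}` and whose row at `v` is `e_v`. -/
def parentMatrix {V : Type*} [DecidableEq V] (v : V) (f : V → V) : Matrix V V ℝ :=
  Matrix.of fun x y => (if x = y then 1 else 0) - if x ≠ v ∧ f x = y then 1 else 0

section ParentMatrix

variable {V : Type*} [Fintype V] [DecidableEq V] {v : V} {f : V → V}

/-- Ordered by height, the matrix is block triangular with identity diagonal blocks. -/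
lemma det_parentMatrix_eq_one_of_height (h : V → ℕ) (hh : ∀ x, x ≠ v → h (f x) < h x) :
    (parentMatrix v f).det = 1 := by
  have htri : (parentMatrix v f).BlockTriangular (fun x => OrderDual.toDual (h x)) := by
    intro x y hxy
    have hxy' : h x < h y := hxy
    have h1 : x ≠ y := by rintro rfl; exact lt_irrefl _ hxy'
    have h2 : ¬ (x ≠ v ∧ f x = y) := by
      rintro ⟨hx, rfl⟩
      exact absurd (hh x hx) (by omega)
    simp [parentMatrix, h1, h2]
  rw [htri.det]
  refine Finset.prod_eq_one fun c _ => ?_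
  have : (parentMatrix v f).toSquareBlock (fun x => OrderDual.toDual (h x)) c = 1 := by
    ext ⟨x, hx⟩ ⟨y, hy⟩
    have hxy : h x = h y := OrderDual.toDual.injective (hx.trans hy.symm)
    have h2 : ¬ (x ≠ v ∧ f x = y) := by
      rintro ⟨hx, rfl⟩
      exact absurd (hh x hx) (by omega)
    simp [parentMatrix, Matrix.toSquareBlock_def, h2, Matrix.one_apply]
  rw [this, Matrix.det_one]

/-- The indicator of the vertices whose orbit misses `v` is a nonzero kernel vector. -/
lemma det_parentMatrix_eq_zero {x : V} (hx : ∀ i, f^[i] x ≠ v) :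
    (parentMatrix v f).det = 0 := by
  classical
  rw [← Matrix.exists_mulVec_eq_zero_iff]
  refine ⟨fun y => if ∀ i, f^[i] y ≠ v then 1 else 0, fun h0 => ?_, ?_⟩
  · have := congrFun h0 x
    simp [hx] at this
  · ext y
    simp only [parentMatrix, Matrix.mulVec, dotProduct, Matrix.of_apply, sub_mul,
      Finset.sum_sub_distrib, ite_mul, one_mul, zero_mul, Pi.zero_apply]
    rw [Finset.sum_ite_eq Finset.univ y, if_pos (Finset.mem_univ y)]
    by_cases hy : y = v
    · subst hy
      have : ¬ ∀ i, f^[i] y ≠ y := fun h => h 0 rfl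
      simp [this]
    · have key : (∀ i, f^[i] y ≠ v) ↔ ∀ i, f^[i] (f y) ≠ v := by
        constructor
        · intro h i
          simpa using h (i + 1)
        · intro h i
          cases i with
          | zero => simpa using hy
          | succ i => simpa using h i
      simp [hy, key]

/-- If every orbit reaches `v`, the hitting time serves as a height; otherwise the determinant
vanishes. This lets terms not coming from trees be dropped. -/
lemma det_parentMatrix_nonneg (v : V) (f : V → V) : 0 ≤ (parentMatrix v f).det := by
  classical
  by_cases h : ∀ x, ∃ i, f^[i] x = v
  · rw [det_parentMatrix_eq_one_of_height (fun x => Nat.find (h x))]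
    · exact zero_le_one
    · intro x hx
      have h1 := Nat.find_spec (h x)
      obtain ⟨j, hj⟩ : ∃ j, Nat.find (h x) = j + 1 := by
        refine Nat.exists_eq_succ_of_ne_zero fun h0 => hx ?_
        rw [h0] at h1
        simpa using h1
      rw [hj] at h1
      have := Nat.find_min' (h (f x)) (m := j) (by simpa using h1)
      omega
  · push Not at h
    obtain ⟨x, hx⟩ := h
    rw [det_parentMatrix_eq_zero hx]

end ParentMatrix

/-! ### Grounded Laplacian and half of the matrix-tree theorem. -/

/-- The Laplacian of the (not necessarily symmetric) weights `w`, with the row at `v` replaced by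
the standard basis vector `e_v`. -/
def groundedLaplacian {V : Type*} [Fintype V] [DecidableEq V] (w : V → V → ℝ) (v : V) :
    Matrix V V ℝ :=
  Matrix.of fun x y => if x = v then (if y = v then 1 else 0)
    else (if x = y then ∑ u, w x u else 0) - w x y

/-- Row x ≠ v is ∑_u w(x,u)(e_x - e_u), so multilinearity in the rows expands the determinant over
the choices u = f x. -/
lemma det_groundedLaplacian {V : Type*} [Fintype V] [DecidableEq V] (w : V → V → ℝ) (v : V) :
    (groundedLaplacian w v).det = ∑ f : V → V,
      (∏ x, if x = v then (if f x = v then 1 else 0) else w x (f x)) * (parentMatrix v f).det := by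
  let g : V → V → V → ℝ := fun x u =>
    (if x = v then (if u = v then 1 else 0) else w x u) •
      fun y => (if x = y then 1 else 0) - if x ≠ v ∧ u = y then 1 else 0
  have hg : groundedLaplacian w v = fun x => ∑ u, g x u := by
    ext x y
    by_cases hx : x = v
    · subst hx
      simp only [groundedLaplacian, g, Finset.sum_apply, Pi.smul_apply, smul_eq_mul,
        Matrix.of_apply, if_true, ne_eq, not_true_eq_false, false_and, if_false, sub_zero]
      simp [eq_comm]
    · simp [groundedLaplacian, g, Finset.sum_apply, hx, mul_sub, Finset.sum_sub_distrib]
  have h := (Matrix.detRowAlternating (n := V) (R := ℝ)).toMultilinearMap.map_sum g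
  rw [hg]
  refine Eq.trans h (Finset.sum_congr rfl fun f _ => ?_)
  have h2 := (Matrix.detRowAlternating (n := V) (R := ℝ)).toMultilinearMap.map_smul_univ
    (fun x => if x = v then (if f x = v then (1 : ℝ) else 0) else w x (f x)) (parentMatrix v f)
  exact h2

namespace SimpleGraph

variable {V : Type*} {T : SimpleGraph V} {v : V}

/-- `f` sends each vertex other than `v` to a neighbour in `T` that is closer to `v`. -/
structure IsParentMap (T : SimpleGraph V) (v : V) (f : V → V) : Prop where
  root : f v = v
  adj : ∀ x, x ≠ v → T.Adj x (f x)
  dist_lt : ∀ x, x ≠ v → T.dist (f x) v < T.dist x v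

/-- The parent is the second vertex of a shortest walk to `v`. -/
lemma Connected.exists_isParentMap (hT : T.Connected) (v : V) : ∃ f, T.IsParentMap v f := by
  classical
  have h : ∀ x, ∃ y, (x = v → y = v) ∧ (x ≠ v → T.Adj x y ∧ T.dist y v < T.dist x v) := by
    intro x
    by_cases hx : x = v
    · exact ⟨v, fun _ => rfl, fun h => absurd hx h⟩
    · obtain ⟨p, hp⟩ := hT.exists_walk_length_eq_dist x v
      cases p with
      | nil => exact absurd rfl hx
      | cons hadj q =>
        refine ⟨_, fun h => absurd h hx, fun _ => ⟨hadj, ?_⟩⟩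
        rw [← hp, Walk.length_cons]
        exact Nat.lt_succ_of_le (dist_le q)
  choose f hf using h
  exact ⟨f, (hf v).1 rfl, fun x hx => ((hf x).2 hx).1, fun x hx => ((hf x).2 hx).2⟩

/-- The edges {x, f x} with x ≠ v are distinct, and there are as many as a tree has edges, so they
are all of them. Hence a parent map determines its tree. -/
lemma IsParentMap.adj_iff [Finite V] {f : V → V} (hf : T.IsParentMap v f) (hT : T.IsTree)
    {x y : V} : T.Adj x y ↔ (x ≠ v ∧ f x = y) ∨ (y ≠ v ∧ f y = x) := by
  classical
  have := Fintype.ofFinite V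
  constructor
  · intro hxy
    have hinj : Set.InjOn (fun x => s(x, f x)) (Finset.univ.erase v : Finset V) := by
      intro x hx y hy hxy
      have hx' : x ≠ v := by simpa using hx
      have hy' : y ≠ v := by simpa using hy
      -- If the edge were shared by x ≠ y, each endpoint would be strictly closer to `v` than the
      -- other.
      rcases Sym2.eq_iff.1 hxy with h | h
      · exact h.1
      · have h1 := hf.dist_lt x hx'
        have h2 := hf.dist_lt y hy'
        rw [h.2] at h1
        rw [← h.1] at h2
        omega
    have himg : (Finset.univ.erase v).image (fun x => s(x, f x)) = T.edgeFinset := by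
      refine Finset.eq_of_subset_of_card_le ?_ ?_
      · intro e he
        obtain ⟨x, hx, rfl⟩ := Finset.mem_image.1 he
        simpa using hf.adj x (by simpa using hx)
      · rw [Finset.card_image_of_injOn hinj, Finset.card_erase_of_mem (Finset.mem_univ v),
          Finset.card_univ, ← hT.card_edgeFinset]
        simp
    have he : s(x, y) ∈ T.edgeFinset := by simpa using hxy
    rw [← himg] at he
    obtain ⟨u, hu, hue⟩ := Finset.mem_image.1 he
    have hu' : u ≠ v := by simpa using hu
    rcases Sym2.eq_iff.1 hue with ⟨rfl, h⟩ | ⟨rfl, h⟩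
    · exact Or.inl ⟨hu', h⟩
    · exact Or.inr ⟨hu', h⟩
  · rintro (⟨hx, rfl⟩ | ⟨hy, rfl⟩)
    · exact hf.adj x hx
    · exact (hf.adj y hy).symm

lemma IsParentMap.degree_root [Fintype V] [DecidableEq V] {f : V → V} (hf : T.IsParentMap v f)
    (hT : T.IsTree) [Fintype (T.neighborSet v)] :
    T.degree v = (Finset.univ.filter fun x => x ≠ v ∧ f x = v).card := by
  rw [← card_neighborFinset_eq_degree]
  congr 1
  ext x
  simp [hf.adj_iff hT]

end SimpleGraph

open Classical in
/-- Half of the matrix-tree theorem: spanning trees, weighted by `z` to the degree of the root,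
are bounded by the determinant of the grounded Laplacian. -/
lemma sum_spanningTrees_pow_degree_le {V : Type*} [Fintype V] (G : SimpleGraph V)
    (v : V) {z : ℝ} (hz : 0 ≤ z) :
    ∑ T : SimpleGraph V with T ∈ spanningTrees G, z ^ T.degree v ≤
      (groundedLaplacian (fun x y => if G.Adj x y then (if x = v ∨ y = v then z else 1) else 0)
        v).det := by
  have hex : ∀ T : SimpleGraph V, ∃ f, T ∈ spanningTrees G → T.IsParentMap v f := fun T => by
    by_cases hT : T ∈ spanningTrees G
    · obtain ⟨f, hf⟩ := hT.2.1.exists_isParentMap v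
      exact ⟨f, fun _ => hf⟩
    · exact ⟨id, fun h => absurd h hT⟩
  choose F hF using hex
  have hinj : Set.InjOn F (Finset.univ.filter fun T => T ∈ spanningTrees G) := by
    intro T hT T' hT' h
    have hT : T ∈ spanningTrees G := by simpa using hT
    have hT' : T' ∈ spanningTrees G := by simpa using hT'
    ext x y
    rw [(hF T hT).adj_iff hT.2, (hF T' hT').adj_iff hT'.2, h]
  rw [det_groundedLaplacian]
  calc _ = ∑ f ∈ (Finset.univ.filter fun T => T ∈ spanningTrees G).image F,
        (∏ x, if x = v then (if f x = v then 1 else 0) else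
          if G.Adj x (f x) then (if x = v ∨ f x = v then z else 1) else 0) *
            (parentMatrix v f).det := by
        rw [Finset.sum_image hinj]
        refine Finset.sum_congr rfl fun T hT => ?_
        have hT : T ∈ spanningTrees G := by simpa using hT
        have hf := hF T hT
        rw [det_parentMatrix_eq_one_of_height (fun x => T.dist x v) hf.dist_lt, mul_one,
          hf.degree_root hT.2, ← Finset.prod_const, Finset.prod_filter]
        refine Finset.prod_congr rfl fun x _ => ?_
        by_cases hx : x = v
        · subst hx
          simp [hf.root]
        · simp [hx, hT.1 (hf.adj x hx)]
    _ ≤ _ := by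
        refine Finset.sum_le_sum_of_subset_of_nonneg (Finset.subset_univ _) fun f _ _ => ?_
        refine mul_nonneg (Finset.prod_nonneg fun x _ => ?_) (det_parentMatrix_nonneg v f)
        split_ifs <;> first | exact hz | exact zero_le_one | exact le_rfl

/-! ### Cofactors and a Hadamard-type inequality. -/

open Matrix

/-- For `S` with vanishing row and column sums, a rank-one perturbation computes the cofactor. -/
lemma det_add_smul_vecMulVec_eq_mul_det_updateRow {β : Type*} [Fintype β] [DecidableEq β]
    (S : Matrix β β ℝ) (hrow : ∀ i, ∑ j, S i j = 0) (hcol : ∀ j, ∑ i, S i j = 0)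
    (d : β → ℝ) (hs : ∑ i, d i ≠ 0) (v : β) :
    (S + (∑ i, d i)⁻¹ • vecMulVec d d).det =
      (∑ i, d i) * (S.updateRow v (Pi.single v 1)).det := by
  set s := ∑ i, d i with hsdef
  set M := S + s⁻¹ • vecMulVec d d with hM
  -- The rows of M sum to d, as the columns of S sum to zero.
  have h1 : (M.updateRow v d).det = M.det := by
    have h := det_updateRow_sum M v (fun _ => (1 : ℝ))
    have hd : ∑ k, (1 : ℝ) • M k = d := by
      ext j
      have hj : (∑ k, (1 : ℝ) • M k) j = ∑ k, (S k j + s⁻¹ * (d k * d j)) := by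
        rw [Finset.sum_apply]
        exact Finset.sum_congr rfl fun k _ => one_mul _
      rw [hj, Finset.sum_add_distrib, hcol, zero_add, ← Finset.mul_sum, ← Finset.sum_mul, ← hsdef]
      field_simp
    rw [hd] at h
    simpa using h
  -- With d as row v, the rank-one part of every other row is a multiple of it.
  have h2 : (M.updateRow v d).det = (S.updateRow v d).det := by
    refine det_eq_of_forall_row_eq_smul_add_const (fun i => if i = v then 0 else s⁻¹ * d i) v
      (by simp) fun i j => ?_
    by_cases hi : i = v
    · subst hi; simp
    · simp [hi, hM, vecMulVec_apply, mul_assoc]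
  -- All rows are now orthogonal to the all-ones vector.
  have h3 : (S.updateRow v (d - s • Pi.single v 1)).det = 0 := by
    rw [← exists_mulVec_eq_zero_iff]
    refine ⟨fun _ => 1, fun h => by simpa using congrFun h v, ?_⟩
    ext i
    by_cases hi : i = v
    · subst hi
      simp [mulVec, dotProduct, Finset.sum_sub_distrib, ← hsdef, ← Finset.mul_sum]
    · simp [mulVec, dotProduct, hi, hrow]
  have h4 : d = (d - s • Pi.single v 1) + s • Pi.single v 1 := by simp
  rw [← h1, h2, h4, det_updateRow_add, h3, det_updateRow_smul, zero_add]

/-- A normalized form of Hadamard's inequality, through `x ≤ exp (x - 1)` on eigenvalues. -/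
lemma Matrix.PosSemidef.det_le_prod_mul_exp {β : Type*} [Fintype β] [DecidableEq β]
    {M : Matrix β β ℝ} (hM : M.PosSemidef) {d : β → ℝ} (hd : ∀ i, 0 < d i) :
    M.det ≤ (∏ i, d i) * Real.exp (∑ i, (M i i / d i - 1)) := by
  set D : Matrix β β ℝ := diagonal fun i => (Real.sqrt (d i))⁻¹ with hD
  have hE : (D * M * Dᴴ).PosSemidef := hM.mul_mul_conjTranspose_same D
  have hdet : (D * M * Dᴴ).det = (∏ i, d i)⁻¹ * M.det := by
    rw [det_mul, det_mul, det_conjTranspose, hD, det_diagonal, star_trivial, mul_right_comm,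
      ← Finset.prod_mul_distrib, ← Finset.prod_inv_distrib]
    congr 1
    refine Finset.prod_congr rfl fun i _ => ?_
    rw [← mul_inv, Real.mul_self_sqrt (hd i).le]
  have htr : (D * M * Dᴴ).trace = ∑ i, M i i / d i := by
    refine Finset.sum_congr rfl fun i _ => ?_
    rw [diag_apply, hD, diagonal_conjTranspose, mul_diagonal, diagonal_mul, Pi.star_apply,
      star_trivial, mul_right_comm, ← mul_inv, Real.mul_self_sqrt (hd i).le]
    field_simp
  have hle : (D * M * Dᴴ).det ≤ Real.exp (∑ i, (M i i / d i - 1)) := by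
    rw [Finset.sum_sub_distrib, ← htr, hE.isHermitian.det_eq_prod_eigenvalues,
      hE.isHermitian.trace_eq_sum_eigenvalues, ← Finset.sum_sub_distrib, Real.exp_sum]
    refine Finset.prod_le_prod (fun i _ => hE.eigenvalues_nonneg i) fun i _ => ?_
    have := Real.add_one_le_exp (hE.isHermitian.eigenvalues i - 1)
    simpa using this
  rw [hdet] at hle
  have hp : 0 < ∏ i, d i := Finset.prod_pos fun i _ => hd i
  calc M.det = (∏ i, d i) * ((∏ i, d i)⁻¹ * M.det) := by field_simp
    _ ≤ _ := by gcongr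

/-! ### Schur complement of a bipartite Laplacian. -/

section BipartiteSchur

variable {α β : Type*} [Fintype α] [Fintype β] [DecidableEq α] [DecidableEq β]

/-- The Schur complement on the second part of the Laplacian of a weighted bipartite graph with
weighted biadjacency matrix `N`. -/
noncomputable def bipartiteSchur (N : Matrix α β ℝ) : Matrix β β ℝ :=
  diagonal (fun j => ∑ i, N i j) - Nᵀ * diagonal (fun i => (∑ j, N i j)⁻¹) * N

lemma bipartiteSchur_apply (N : Matrix α β ℝ) (j k : β) :
    bipartiteSchur N j k =
      (if j = k then ∑ i, N i j else 0) - ∑ i, N i j * (∑ l, N i l)⁻¹ * N i k := by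
  rw [bipartiteSchur, Matrix.sub_apply, diagonal_apply, mul_apply]
  simp [mul_diagonal]

lemma bipartiteSchur_symm (N : Matrix α β ℝ) (j k : β) :
    bipartiteSchur N j k = bipartiteSchur N k j := by
  rw [bipartiteSchur_apply, bipartiteSchur_apply]
  congr 1
  · by_cases h : j = k
    · subst h; rfl
    · rw [if_neg h, if_neg (Ne.symm h)]
  · exact Finset.sum_congr rfl fun i _ => by ring

lemma sum_bipartiteSchur_row (N : Matrix α β ℝ) (hp : ∀ i, 0 < ∑ j, N i j) (j : β) :
    ∑ k, bipartiteSchur N j k = 0 := by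
  simp only [bipartiteSchur_apply, Finset.sum_sub_distrib]
  rw [Finset.sum_ite_eq Finset.univ j, if_pos (Finset.mem_univ j), Finset.sum_comm, sub_eq_zero]
  refine Finset.sum_congr rfl fun i _ => ?_
  rw [← Finset.mul_sum, mul_assoc, inv_mul_cancel₀ (hp i).ne', mul_one]

/-- The quadratic form is a sum over i of unnormalized variances of x under the weights N i ·, each
nonnegative by Cauchy–Schwarz. -/
lemma bipartiteSchur_posSemidef (N : Matrix α β ℝ) (hN : ∀ i j, 0 ≤ N i j)
    (hp : ∀ i, 0 < ∑ j, N i j) : (bipartiteSchur N).PosSemidef := by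
  rw [posSemidef_iff_dotProduct_mulVec]
  refine ⟨?_, fun x => ?_⟩
  · ext j k
    simpa using bipartiteSchur_symm N k j
  · have key : star x ⬝ᵥ (bipartiteSchur N *ᵥ x) =
        ∑ i, (∑ j, N i j * x j ^ 2 - (∑ j, N i j)⁻¹ * (∑ j, N i j * x j) ^ 2) := by
      have h1 : ∀ i, (∑ j, N i j)⁻¹ * (∑ j, N i j * x j) ^ 2 =
          ∑ j, ∑ k, x j * (N i j * (∑ l, N i l)⁻¹ * N i k) * x k := by
        intro i
        rw [sq, Finset.sum_mul_sum, Finset.mul_sum]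
        refine Finset.sum_congr rfl fun j _ => ?_
        rw [Finset.mul_sum]
        exact Finset.sum_congr rfl fun k _ => by ring
      have h2 : ∀ j, x j * ∑ k, bipartiteSchur N j k * x k = ∑ i, N i j * x j ^ 2 -
          ∑ i, ∑ k, x j * (N i j * (∑ l, N i l)⁻¹ * N i k) * x k := by
        intro j
        simp only [bipartiteSchur_apply, sub_mul, Finset.sum_sub_distrib, mul_sub, ite_mul,
          zero_mul]
        rw [Finset.sum_ite_eq Finset.univ j, if_pos (Finset.mem_univ j)]
        congr 1
        · rw [Finset.sum_mul, Finset.mul_sum]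
          exact Finset.sum_congr rfl fun i _ => by ring
        · rw [Finset.sum_comm, Finset.mul_sum]
          refine Finset.sum_congr rfl fun k _ => ?_
          rw [Finset.sum_mul, Finset.mul_sum]
          exact Finset.sum_congr rfl fun i _ => by ring
      calc star x ⬝ᵥ (bipartiteSchur N *ᵥ x) = ∑ j, x j * ∑ k, bipartiteSchur N j k * x k := rfl
        _ = _ := by
          simp only [h1, h2, Finset.sum_sub_distrib]
          congr 1 <;> exact Finset.sum_comm
    rw [key]
    refine Finset.sum_nonneg fun i _ => ?_
    have hcs : (∑ j, N i j * x j) ^ 2 ≤ (∑ j, N i j) * ∑ j, N i j * x j ^ 2 :=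
      Finset.sum_sq_le_sum_mul_sum_of_sq_le_mul _ (fun j _ => hN i j)
        (fun j _ => mul_nonneg (hN i j) (sq_nonneg _)) fun j _ => le_of_eq (by ring)
    rw [sub_nonneg, inv_mul_le_iff₀ (hp i)]
    exact hcs

lemma det_bipartiteSchur_updateRow_le (N : Matrix α β ℝ) (hN : ∀ i j, 0 ≤ N i j)
    (hp : ∀ i, 0 < ∑ j, N i j) (hd : ∀ j, 0 < ∑ i, N i j) (v : β) :
    ((bipartiteSchur N).updateRow v (Pi.single v 1)).det ≤
      (∏ j, ∑ i, N i j) / (∑ j, ∑ i, N i j) *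
        Real.exp (1 - ∑ i, ∑ j, N i j ^ 2 / ((∑ l, N i l) * ∑ l, N l j)) := by
  have hs : 0 < ∑ j, ∑ i, N i j := Finset.sum_pos (fun j _ => hd j) ⟨v, Finset.mem_univ v⟩
  have hdet := det_add_smul_vecMulVec_eq_mul_det_updateRow (bipartiteSchur N)
    (sum_bipartiteSchur_row N hp)
    (fun k => by
      rw [← sum_bipartiteSchur_row N hp k]
      exact Finset.sum_congr rfl fun j _ => bipartiteSchur_symm N j k)
    (fun j => ∑ i, N i j) hs.ne' v
  set d : β → ℝ := fun j => ∑ i, N i j with hddef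
  have hpsd : (bipartiteSchur N + (∑ j, d j)⁻¹ • vecMulVec d d).PosSemidef := by
    refine (bipartiteSchur_posSemidef N hN hp).add (PosSemidef.smul ?_ (inv_nonneg.2 hs.le))
    simpa using posSemidef_vecMulVec_self_star d
  have hle := hpsd.det_le_prod_mul_exp hd
  have hsum : ∑ j, ((bipartiteSchur N + (∑ j, d j)⁻¹ • vecMulVec d d) j j / d j - 1) =
      1 - ∑ i, ∑ j, N i j ^ 2 / ((∑ l, N i l) * ∑ l, N l j) := by
    have hj : ∀ j, (bipartiteSchur N + (∑ j, d j)⁻¹ • vecMulVec d d) j j / d j - 1 =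
        (∑ j, d j)⁻¹ * d j - ∑ i, N i j ^ 2 / ((∑ l, N i l) * ∑ l, N l j) := by
      intro j
      have hdj : d j ≠ 0 := (hd j).ne'
      have : ∑ i, N i j ^ 2 / ((∑ l, N i l) * ∑ l, N l j) =
          (∑ i, N i j * (∑ l, N i l)⁻¹ * N i j) / d j := by
        rw [Finset.sum_div]
        refine Finset.sum_congr rfl fun i _ => ?_
        have := (hp i).ne'
        have : d j = ∑ l, N l j := rfl
        rw [this, div_eq_div_iff (mul_ne_zero (hp i).ne' (hd j).ne') (hd j).ne']
        field_simp [(hp i).ne']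
      rw [this, Matrix.add_apply, bipartiteSchur_apply, if_pos rfl, Matrix.smul_apply,
        vecMulVec_apply, smul_eq_mul]
      change (d j - _ + _) / d j - 1 = _
      field_simp
      ring
    simp only [hj, Finset.sum_sub_distrib]
    rw [← Finset.mul_sum, inv_mul_cancel₀ hs.ne', Finset.sum_comm]
  rw [hsum, hdet] at hle
  rw [div_mul_eq_mul_div, le_div_iff₀ hs, mul_comm]
  exact hle

end BipartiteSchur

/-- The grounded Laplacian of a bipartite weighted graph, computed by its Schur complement. -/
lemma det_groundedLaplacian_of_bipartite {V : Type*} [Fintype V] [DecidableEq V]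
    (w : V → V → ℝ) (p : V → Prop) [DecidablePred p] (hsymm : ∀ x y, w x y = w y x)
    (hpp : ∀ x y, p x → p y → w x y = 0) (hnn : ∀ x y, ¬ p x → ¬ p y → w x y = 0)
    (hpos : ∀ x, p x → 0 < ∑ y : {y // ¬ p y}, w x y) (v : {y // ¬ p y}) :
    (groundedLaplacian w v).det =
      (∏ x : {x // p x}, ∑ y : {y // ¬ p y}, w x y) *
        ((bipartiteSchur (of fun (x : {x // p x}) (y : {y // ¬ p y}) => w x y)).updateRow v
          (Pi.single v 1)).det := by
  set N : Matrix {x // p x} {y // ¬ p y} ℝ := of fun x y => w x y with hN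
  set P : {x // p x} → ℝ := fun x => ∑ y : {y // ¬ p y}, w x y with hP
  have hPpos : ∀ x, 0 < P x := fun x => hpos x x.2
  have hrow : ∀ x : {x // p x}, ∑ y, w x y = P x := by
    intro x
    rw [← Fintype.sum_subtype_add_sum_subtype p, Finset.sum_eq_zero, zero_add]
    exact fun y _ => hpp x y x.2 y.2
  have hcol : ∀ y : {y // ¬ p y}, ∑ x, w y x = ∑ x : {x // p x}, w x y := by
    intro y
    rw [← Fintype.sum_subtype_add_sum_subtype p,
      Finset.sum_eq_zero (s := (Finset.univ : Finset {x // ¬ p x}))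
        fun x _ => hnn y x y.2 x.2, add_zero]
    exact Finset.sum_congr rfl fun x _ => hsymm _ _
  have hne : ∀ x : {x // p x}, (x : V) ≠ v := fun x h => v.2 (h ▸ x.2)
  have hA : toBlock (groundedLaplacian w v) p p = diagonal P := by
    ext x y
    rw [toBlock_apply, groundedLaplacian, of_apply, if_neg (hne x), hpp x y x.2 y.2, sub_zero,
      hrow, diagonal_apply]
    simp only [Subtype.ext_iff]
  have hB : toBlock (groundedLaplacian w v) p (fun y => ¬ p y) = -N := by
    ext x y
    have : (x : V) ≠ y := fun h => y.2 (h ▸ x.2)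
    rw [toBlock_apply, groundedLaplacian, of_apply, if_neg (hne x), if_neg this, zero_sub]
    rfl
  let _ : Invertible (diagonal P) := invertibleOfIsUnitDet _ (by
    rw [det_diagonal]
    exact (Finset.prod_pos fun x _ => hPpos x).ne'.isUnit)
  have hinv : ⅟(diagonal P) = diagonal fun x => (P x)⁻¹ := by
    refine invOf_eq_right_inv ?_
    rw [diagonal_mul_diagonal, ← diagonal_one]
    congr 1
    funext x
    exact mul_inv_cancel₀ (hPpos x).ne'
  rw [det_toBlock _ p, hA, hB, det_fromBlocks₁₁, det_diagonal, hinv]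
  congr 2
  ext y k
  rw [Matrix.sub_apply, mul_apply]
  simp only [mul_diagonal, toBlock_apply, groundedLaplacian, of_apply, Matrix.neg_apply]
  by_cases hy : y = v
  -- Row `v` has no entries in the eliminated part, so elimination leaves e_v unchanged.
  · subst hy
    have hne' : ∀ x : {x // p x}, (x : V) ≠ y := hne
    simp [updateRow_self, Pi.single_apply, Subtype.ext_iff, hne']
  · have hy' : (y : V) ≠ v := fun h => hy (Subtype.ext h)
    have hyx : ∀ x : {x // p x}, (y : V) ≠ x := fun x h => y.2 (h ▸ x.2)
    rw [updateRow_ne hy, bipartiteSchur_apply, hnn y k y.2 k.2, hcol]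
    simp only [if_neg hy', if_neg (hyx _), Subtype.ext_iff, zero_sub, sub_zero, hN, of_apply, hP]
    congr 1
    refine Finset.sum_congr rfl fun x _ => ?_
    rw [hsymm y x]
    ring

/-! ### The generating function bound for biregular graphs. -/

open Classical in
lemma sum_spanningTrees_pow_degree_le_of_biregular {V : Type*} [Fintype V] (G : SimpleGraph V)
    (A B : Finset V) (hcover : A ∪ B = Finset.univ)
    (hbip : G.IsBipartiteWith (A : Set V) (B : Set V)) (n m a b : ℕ) (hn : A.card = n)
    (hm : B.card = m) (ha : ∀ u ∈ A, G.degree u = a) (hb : ∀ w ∈ B, G.degree w = b)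
    (v : V) (hv : v ∈ B) (ha0 : 0 < a) (hb0 : 0 < b) {z : ℝ} (hz : 0 < z) :
    ∑ T : SimpleGraph V with T ∈ spanningTrees G, z ^ T.degree v ≤
      z * Real.exp ((z - 1) * b / a) * ((a : ℝ) ^ n * (b : ℝ) ^ m / (((m : ℝ) - 1 + z) * n)) := by
  obtain ⟨p, hpA⟩ : ∃ p : V → Prop, ∀ x, p x ↔ x ∈ A := ⟨_, fun _ => Iff.rfl⟩
  have hAB : ∀ x, ¬ p x ↔ x ∈ B := fun x => by
    rw [hpA]
    constructor
    · intro hx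
      have : x ∈ A ∪ B := hcover ▸ Finset.mem_univ x
      exact (Finset.mem_union.1 this).resolve_left hx
    · intro hx hx'
      exact Set.disjoint_left.1 hbip.disjoint hx' hx
  have hadjA : ∀ x y, G.Adj x y → (p x ↔ ¬ p y) := fun x y h => by
    rcases hbip.mem_of_adj h with ⟨h1, h2⟩ | ⟨h1, h2⟩
    · exact iff_of_true ((hpA x).2 h1) ((hAB y).2 h2)
    · exact iff_of_false ((hAB x).2 h1) (not_not.2 ((hpA y).2 h2))
  set w : V → V → ℝ := fun x y => if G.Adj x y then (if x = v ∨ y = v then z else 1) else 0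
    with hw
  have hvA : ¬ p v := (hAB v).2 hv
  let v₀ : {y // ¬ p y} := ⟨v, hvA⟩
  set c : {y // ¬ p y} → ℝ := fun y => if y = v₀ then z else 1 with hc
  have hcpos : ∀ y, 0 < c y := fun y => by
    simp only [hc]; split_ifs <;> [exact hz; exact one_pos]
  have hwc : ∀ (x : {x // p x}) (y : {y // ¬ p y}),
      w x y = if G.Adj x y then c y else 0 := fun x y => by
    have : (x : V) ≠ v := fun h => hvA (h ▸ x.2)
    simp [hw, hc, this, v₀, Subtype.ext_iff]
  have hnA : ∀ x, p x → ∑ y : {y // ¬ p y}, (if G.Adj x y then (1 : ℝ) else 0) = a := by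
    intro x hx
    have h0 : ∑ y : {x // p x}, (if G.Adj x y then (1 : ℝ) else 0) = 0 :=
      Finset.sum_eq_zero fun y _ => if_neg fun h => (hadjA x y h).1 hx y.2
    have := Fintype.sum_subtype_add_sum_subtype p (fun y => if G.Adj x y then (1 : ℝ) else 0)
    rw [h0, zero_add] at this
    rw [this, ← ha x ((hpA x).1 hx), ← SimpleGraph.card_neighborFinset_eq_degree,
      SimpleGraph.neighborFinset_eq_filter, Finset.sum_boole]
  have hnB : ∀ y : {y // ¬ p y}, ∑ x : {x // p x}, (if G.Adj x y then (1 : ℝ) else 0) = b := by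
    intro y
    have h0 : ∑ x : {x // ¬ p x}, (if G.Adj x y then (1 : ℝ) else 0) = 0 :=
      Finset.sum_eq_zero fun x _ => if_neg fun h => x.2 ((hadjA x y h).2 y.2)
    have := Fintype.sum_subtype_add_sum_subtype p (fun x => if G.Adj x y then (1 : ℝ) else 0)
    rw [h0, add_zero] at this
    rw [this, ← hb y ((hAB y).1 y.2), ← SimpleGraph.card_neighborFinset_eq_degree,
      SimpleGraph.neighborFinset_eq_filter, Finset.sum_boole]
    simp only [G.adj_comm]
  have hp : ∀ x : {x // p x}, ∑ y : {y // ¬ p y}, w x y =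
      a + (z - 1) * if G.Adj x v then 1 else 0 := by
    intro x
    have h1 : ∀ y : {y // ¬ p y}, w x y = (if G.Adj x y then (1 : ℝ) else 0) +
        if y = v₀ then (z - 1) * (if G.Adj x v then 1 else 0) else 0 := by
      intro y
      rw [hwc]
      by_cases hy : y = v₀
      · subst hy
        by_cases h : G.Adj x v <;> simp [hc, v₀, h]
      · simp [hc, hy]
    rw [Finset.sum_congr rfl fun y _ => h1 y, Finset.sum_add_distrib, hnA x x.2,
      Finset.sum_ite_eq' Finset.univ v₀, if_pos (Finset.mem_univ _)]
  have ha1 : (1 : ℝ) ≤ a := by exact_mod_cast ha0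
  have hbR : (0 : ℝ) < b := by exact_mod_cast hb0
  have hppos : ∀ x : {x // p x}, 0 < ∑ y : {y // ¬ p y}, w x y := by
    intro x
    rw [hp]
    split_ifs <;> linarith
  have hd : ∀ y : {y // ¬ p y}, ∑ x : {x // p x}, w x y = c y * b := by
    intro y
    rw [← hnB y, Finset.mul_sum]
    exact Finset.sum_congr rfl fun x _ => by rw [hwc]; simp
  have hcardA : Fintype.card {x // p x} = n := by
    simp only [hpA]
    simp [hn]
  have hcardB : Fintype.card {y // ¬ p y} = m := by
    simp only [hAB]
    simp [hm]
  have hm1 : (1 : ℝ) ≤ m := by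
    rw [← hm]
    exact_mod_cast Finset.card_pos.2 ⟨v, hv⟩
  have hn0 : (0 : ℝ) < n := by
    obtain ⟨u, hu⟩ : ∃ u, G.Adj v u := by
      have : 0 < G.degree v := by rw [hb v hv]; exact hb0
      exact (G.degree_pos_iff_exists_adj v).1 this
    have huA : u ∈ A := by
      rw [← hpA]
      by_contra h
      exact hvA ((hadjA v u hu).2 h)
    rw [← hn]
    exact_mod_cast Finset.card_pos.2 ⟨u, huA⟩
  have hprodd : ∏ y : {y // ¬ p y}, ∑ x : {x // p x}, w x y = z * b ^ m := by
    simp only [hd]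
    rw [Finset.prod_mul_distrib, Finset.prod_const, Finset.card_univ, hcardB]
    simp [hc]
  have hsumd : ∑ y : {y // ¬ p y}, ∑ x : {x // p x}, w x y = (m - 1 + z) * b := by
    simp only [hd]
    rw [← Finset.sum_mul]
    congr 1
    have : ∀ y, c y = 1 + if y = v₀ then z - 1 else 0 := fun y => by
      simp only [hc]; split_ifs <;> ring
    simp only [this, Finset.sum_add_distrib]
    rw [Finset.sum_ite_eq' Finset.univ v₀, if_pos (Finset.mem_univ _)]
    simp only [Finset.sum_const, Finset.card_univ, hcardB, nsmul_eq_mul]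
    ring
  -- A nonzero weight is c y and its column sum is c y * b, so z cancels and each row contributes 1
  -- / b.
  have hquad : ∑ x : {x // p x}, ∑ y : {y // ¬ p y}, w x y ^ 2 /
      ((∑ l : {y // ¬ p y}, w x l) * ∑ l : {x // p x}, w l y) = n / b := by
    have h1 : ∀ x : {x // p x}, ∑ y : {y // ¬ p y}, w x y ^ 2 /
        ((∑ l : {y // ¬ p y}, w x l) * ∑ l : {x // p x}, w l y) = 1 / b := by
      intro x
      have h2 : ∀ y : {y // ¬ p y}, w x y ^ 2 /
          ((∑ l : {y // ¬ p y}, w x l) * ∑ l : {x // p x}, w l y) =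
          w x y / ((∑ l : {y // ¬ p y}, w x l) * b) := by
        intro y
        have hx := (hppos x).ne'
        have hy := (hcpos y).ne'
        rw [hd, hwc]
        split_ifs
        · field_simp
        · simp
      rw [Finset.sum_congr rfl fun y _ => h2 y, ← Finset.sum_div]
      have hx := (hppos x).ne'
      field_simp
    rw [Finset.sum_congr rfl fun x _ => h1 x, Finset.sum_const, Finset.card_univ, hcardA,
      nsmul_eq_mul]
    ring
  have hprodp : ∏ x : {x // p x}, ∑ y : {y // ¬ p y}, w x y ≤
      (a : ℝ) ^ n * Real.exp ((z - 1) * b / a) := by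
    calc _ ≤ ∏ x : {x // p x},
          ((a : ℝ) * Real.exp ((z - 1) / a * if G.Adj x v then 1 else 0)) := by
          refine Finset.prod_le_prod (fun x _ => (hppos x).le) fun x _ => ?_
          rw [hp]
          have := Real.add_one_le_exp ((z - 1) / a * if G.Adj x v then 1 else 0)
          calc (a : ℝ) + (z - 1) * (if G.Adj x v then 1 else 0)
              = a * ((z - 1) / a * (if G.Adj x v then 1 else 0) + 1) := by field_simp; ring
            _ ≤ _ := by gcongr
      _ = _ := by
          rw [Finset.prod_mul_distrib, Finset.prod_const, Finset.card_univ, hcardA,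
            ← Real.exp_sum, ← Finset.mul_sum, hnB v₀]
          congr 2
          ring
  -- This is x ≤ exp (x - 1) at x = n / b, inverted.
  have hexp : Real.exp (1 - n / b) ≤ b / n := by
    have h := Real.add_one_le_exp ((n : ℝ) / b - 1)
    rw [sub_add_cancel] at h
    have h2 : Real.exp (1 - n / b) = (Real.exp ((n : ℝ) / b - 1))⁻¹ := by
      rw [← Real.exp_neg]; congr 1; ring
    rw [h2, ← inv_div (n : ℝ) b]
    exact inv_anti₀ (by positivity) h
  refine (sum_spanningTrees_pow_degree_le G v hz.le).trans ?_
  have hdet := det_groundedLaplacian_of_bipartite w p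
    (fun x y => by simp only [hw, G.adj_comm x y, or_comm])
    (fun x y hx hy => if_neg fun h => (hadjA x y h).1 hx hy)
    (fun x y hx hy => if_neg fun h => hx ((hadjA x y h).2 hy))
    (fun x hx => hppos ⟨x, hx⟩) v₀
  have hschur := det_bipartiteSchur_updateRow_le
    (of fun (x : {x // p x}) (y : {y // ¬ p y}) => w x y)
    (fun x y => by
      rw [of_apply, hwc]
      split_ifs <;> [exact (hcpos y).le; exact le_rfl])
    hppos (fun y => by simp only [of_apply, hd]; exact mul_pos (hcpos y) hbR) v₀
  simp only [of_apply] at hschur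
  rw [hprodd, hsumd, hquad] at hschur
  have hmz : 0 < (m : ℝ) - 1 + z := by linarith
  have hschur' := hschur.trans (mul_le_mul_of_nonneg_left hexp (by positivity))
  have hprod0 : 0 ≤ ∏ x : {x // p x}, ∑ y : {y // ¬ p y}, w x y :=
    Finset.prod_nonneg fun x _ => (hppos x).le
  change (groundedLaplacian w v₀).det ≤ _
  rw [hdet]
  calc _ ≤ (∏ x : {x // p x}, ∑ y : {y // ¬ p y}, w x y) *
        (z * b ^ m / ((m - 1 + z) * b) * (b / n)) := mul_le_mul_of_nonneg_left hschur' hprod0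
    _ ≤ ((a : ℝ) ^ n * Real.exp ((z - 1) * b / a)) *
        (z * b ^ m / ((m - 1 + z) * b) * (b / n)) :=
        mul_le_mul_of_nonneg_right hprodp (by positivity)
    _ = z * Real.exp ((z - 1) * b / a) * ((a : ℝ) ^ n * (b : ℝ) ^ m / (((m : ℝ) - 1 + z) * n)) := by
        field_simp

/-! ### Markov bounds and conclusion. -/

open Classical in
lemma treesDegGT_mul_pow_le {V : Type*} [Fintype V] (G : SimpleGraph V) (v : V) (k : ℕ) {z : ℝ}
    (hz : 1 ≤ z) : treesDegGT G v k * z ^ (k + 1) ≤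
      ∑ T : SimpleGraph V with T ∈ spanningTrees G, z ^ T.degree v := by
  have h : treesDegGT G v k =
      (Finset.univ.filter fun T : SimpleGraph V => T ∈ spanningTrees G ∧ k < T.degree v).card := by
    rw [treesDegGT, ← Set.ncard_coe_finset]
    congr 1
    ext T
    simp
  rw [h, ← nsmul_eq_mul, ← Finset.sum_const]
  calc _ ≤ ∑ T : SimpleGraph V with T ∈ spanningTrees G ∧ k < T.degree v, z ^ T.degree v :=
        Finset.sum_le_sum fun T hT => pow_le_pow_right₀ hz (by simpa using (Finset.mem_filter.1 hT).2.2)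
    _ ≤ _ := Finset.sum_le_sum_of_subset_of_nonneg
        (fun T hT => by
          rw [Finset.mem_filter] at hT ⊢
          exact ⟨hT.1, hT.2.1⟩)
        fun T _ _ => by positivity

open Classical in
lemma treesDegLE_mul_pow_le {V : Type*} [Fintype V] (G : SimpleGraph V) (v : V) (k : ℕ) {z : ℝ}
    (hz0 : 0 ≤ z) (hz : z ≤ 1) : treesDegLE G v k * z ^ k ≤
      ∑ T : SimpleGraph V with T ∈ spanningTrees G, z ^ T.degree v := by
  have h : treesDegLE G v k =
      (Finset.univ.filter fun T : SimpleGraph V => T ∈ spanningTrees G ∧ T.degree v ≤ k).card := by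
    rw [treesDegLE, ← Set.ncard_coe_finset]
    congr 1
    ext T
    simp
  rw [h, ← nsmul_eq_mul, ← Finset.sum_const]
  calc _ ≤ ∑ T : SimpleGraph V with T ∈ spanningTrees G ∧ T.degree v ≤ k, z ^ T.degree v :=
        Finset.sum_le_sum fun T hT => pow_le_pow_of_le_one hz0 hz (Finset.mem_filter.1 hT).2.2
    _ ≤ _ := Finset.sum_le_sum_of_subset_of_nonneg
        (fun T hT => by
          rw [Finset.mem_filter] at hT ⊢
          exact ⟨hT.1, hT.2.1⟩)
        fun T _ _ => by positivity

theorem theorem3 {V : Type*} [Fintype V] [DecidableEq V] (G : SimpleGraph V) [DecidableRel G.Adj]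
    (A B : Finset V) (hcover : A ∪ B = Finset.univ) (hbip : G.IsBipartiteWith (A : Set V) (B : Set V))
    (n m a b : ℕ) (hn : A.card = n) (hm : B.card = m)
    (ha : ∀ u ∈ A, G.degree u = a) (hb : ∀ w ∈ B, G.degree w = b)
    (v : V) (hv : v ∈ B)
    (k : ℕ) (θ : ℝ) (hk : (k : ℝ) = θ * b / a) (hkb : k < b) :
    (1 ≤ θ →
      (treesDegGT G v k : ℝ) ≤
        (θ⁻¹ * Real.exp ((θ - 1) / θ)) ^ k * ((a : ℝ) ^ n * (b : ℝ) ^ m / ((m : ℝ) * n))) ∧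
    (θ ≤ 1 → 2 ≤ m →
      (treesDegLE G v (k + 1) : ℝ) ≤
        (θ⁻¹ * Real.exp ((θ - 1) / θ)) ^ k *
          ((a : ℝ) ^ n * (b : ℝ) ^ m / (((m : ℝ) - 1) * n))) := by
  have hb0 : 0 < b := by omega
  obtain ⟨u, hu⟩ : ∃ u, G.Adj v u := by
    have : 0 < G.degree v := by rw [hb v hv]; exact hb0
    exact (G.degree_pos_iff_exists_adj v).1 this
  have huA : u ∈ A := by
    rcases hbip.mem_of_adj hu with h | h
    · exact absurd hv (Set.disjoint_left.1 hbip.disjoint h.1)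
    · exact h.2
  have ha0 : 0 < a := by
    rw [← ha u huA]
    exact (G.degree_pos_iff_exists_adj u).2 ⟨v, hu.symm⟩
  have haR : (0 : ℝ) < a := by exact_mod_cast ha0
  have hbR : (0 : ℝ) < b := by exact_mod_cast hb0
  have hn0 : (0 : ℝ) < n := by
    rw [← hn]
    exact_mod_cast Finset.card_pos.2 ⟨u, huA⟩
  have hm0 : (0 : ℝ) < m := by
    rw [← hm]
    exact_mod_cast Finset.card_pos.2 ⟨v, hv⟩
  have key := fun (z : ℝ) (hz : 0 < z) => sum_spanningTrees_pow_degree_le_of_biregular G A B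
    (by convert hcover) hbip n m a b hn hm (fun x hx => by convert ha x hx)
    (fun x hx => by convert hb x hx) v hv ha0 hb0 hz
  -- Since k = θb/a, the exponent (θ-1)b/a equals k(θ-1)/θ.
  have hfactor : 0 < θ →
      (θ⁻¹ * Real.exp ((θ - 1) / θ)) ^ k * θ ^ k = Real.exp ((θ - 1) * b / a) := by
    intro hθ
    have hθ' := hθ.ne'
    rw [← mul_pow, mul_right_comm, inv_mul_cancel₀ hθ', one_mul, ← Real.exp_nat_mul, hk]
    congr 1
    field_simp
  constructor
  · intro hθ
    have hθ0 : 0 < θ := by linarith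
    have h := (treesDegGT_mul_pow_le G v k hθ).trans (key θ hθ0)
    rw [← hfactor hθ0] at h
    -- Both parts divide by θ^(k+1): the extra θ is the prefactor z of the generating function
    -- bound, which is why (ii) reaches degree k + 1.
    refine le_of_mul_le_mul_right (h.trans ?_) (pow_pos hθ0 (k + 1))
    calc θ * ((θ⁻¹ * Real.exp ((θ - 1) / θ)) ^ k * θ ^ k) *
          ((a : ℝ) ^ n * (b : ℝ) ^ m / (((m : ℝ) - 1 + θ) * n))
        ≤ θ * ((θ⁻¹ * Real.exp ((θ - 1) / θ)) ^ k * θ ^ k) *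
          ((a : ℝ) ^ n * (b : ℝ) ^ m / ((m : ℝ) * n)) := by
          gcongr
          linarith
      _ = _ := by ring
  · intro hθ hm2
    have hm2' : (2 : ℝ) ≤ m := by exact_mod_cast hm2
    have hm1 : 0 < (m : ℝ) - 1 := by linarith
    have hθn : 0 ≤ θ := by
      have h0 : (0 : ℝ) ≤ θ * b / a := hk ▸ Nat.cast_nonneg k
      by_contra hneg
      push Not at hneg
      have : θ * b / a < 0 := div_neg_of_neg_of_pos (mul_neg_of_neg_of_pos hneg hbR) haR
      linarith
    rcases hθn.eq_or_lt with h0 | hθ0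
    · subst h0
      have hk0 : k = 0 := by
        have : (k : ℝ) = 0 := by simpa using hk
        exact_mod_cast this
      subst hk0
      -- At θ = 0 the choice z = θ is not positive. Any z in (0, 1] works: the prefactor z cancels,
      -- and the exponential is at most 1.
      have h := (treesDegLE_mul_pow_le G v (0 + 1) (z := 1 / 2) (by norm_num) (by norm_num)).trans
        (key (1 / 2) (by norm_num))
      refine le_of_mul_le_mul_right (h.trans ?_) (by norm_num : (0 : ℝ) < (1 / 2) ^ (0 + 1))
      calc (1 / 2 : ℝ) * Real.exp ((1 / 2 - 1) * b / a) *
            ((a : ℝ) ^ n * (b : ℝ) ^ m / (((m : ℝ) - 1 + 1 / 2) * n))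
          ≤ (1 / 2 : ℝ) * 1 * ((a : ℝ) ^ n * (b : ℝ) ^ m / (((m : ℝ) - 1) * n)) := by
            gcongr
            · rw [Real.exp_le_one_iff]
              refine div_nonpos_of_nonpos_of_nonneg ?_ haR.le
              nlinarith
            · linarith
        _ = _ := by ring
    · have h := (treesDegLE_mul_pow_le G v (k + 1) hθn hθ).trans (key θ hθ0)
      rw [← hfactor hθ0] at h
      refine le_of_mul_le_mul_right (h.trans ?_) (pow_pos hθ0 (k + 1))
      calc θ * ((θ⁻¹ * Real.exp ((θ - 1) / θ)) ^ k * θ ^ k) *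
            ((a : ℝ) ^ n * (b : ℝ) ^ m / (((m : ℝ) - 1 + θ) * n))
          ≤ θ * ((θ⁻¹ * Real.exp ((θ - 1) / θ)) ^ k * θ ^ k) *
            ((a : ℝ) ^ n * (b : ℝ) ^ m / (((m : ℝ) - 1) * n)) := by
            gcongr
            linarith
        _ = _ := by ring
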